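/- Let $d$ and $D$ be positive integers. All graphs are simple, not necessarily connected, and have all vertex degrees at most $d$. For a graph $G$, a vertex $x$ and an integer $r\ge 0$, let $B_r(G,x)$ be the ball of radius $r$ around $x$ in the shortest path distance (vertices in different components are at distance $\infty$), regarded as an induced subgraph rooted at $x$. A graph $G$ is $D$-doubling if $|B_{2s}(G,x)|\le D\,|B_s(G,x)|$ for all $x\in V(G)$ and all integers $s\ge 1$. For graphs $G,H$ let $d_{Gr}(G,H)=2^{-n}$, where $n\ge 0$ is the largest integer such that, for every $1\le i\le n$, the sets of rooted isomorphism classes of balls $\{B_i(G,x): x\in V(G)\}$ and $\{B_i(H,y): y\in V(H)\}$ coincide, and $d_{Gr}(G,H)=0$ if these sets coincide for every $i\ge1$. The sequence $G_n$ converges topologically to $G$ if $d_{Gr}(G_n,G)\to 0$. Let $\Delta_G:\ell^2(V(G))\to\ell^2(V(G))$, $(\Delta_G f)(x)=\deg(x)f(x)-\sum_{y\sim x}f(y)$, be the graph Laplacian, a bounded operator, and let $\operatorname{spec}(G)$ be its spectrum. Theorem. Let $(G_n)_{n\ge 1}$ be a sequence of $D$-doubling countable graphs of vertex degree at most $d$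 that converges topologically to a graph $G$ of vertex degree at most $d$. Then $\operatorname{spec}(G_n)\to\operatorname{spec}(G)$ in the Hausdorff topology, that is, the Hausdorff distance between $\operatorname{spec}(G_n)$ and $\operatorname{spec}(G)$ tends to $0$. -/

import Mathlib

open Filter Topology
open scoped ENNReal

namespace GraphSpec

/-- The ball `B_r(G, x)` of radius `r` around `x` for the shortest path distance; vertices of
other components are at distance `⊤`. -/
def closedBall {V : Type*} (G : SimpleGraph V) (x : V) (r : ℕ) : Set V :=
  {y | G.edist x y ≤ r}

theorem self_mem_closedBall {V : Type*} (G : SimpleGraph V) (x : V) (r : ℕ) :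
    x ∈ closedBall G x r := by
  simp [closedBall]

/-- `G` is `D`-doubling: `|B_{2s}(G, x)| ≤ D |B_s(G, x)|` for all vertices `x` and all `s ≥ 1`. -/
def IsDoubling {V : Type*} (G : SimpleGraph V) (D : ℕ) : Prop :=
  ∀ (x : V) (s : ℕ), 1 ≤ s → (closedBall G x (2 * s)).encard ≤ D * (closedBall G x s).encard

/-- The balls `B_r(G, x)` and `B_r(H, y)`, as induced subgraphs rooted at `x` and `y`, are
rooted-isomorphic. -/
def BallIso {V W : Type*} (G : SimpleGraph V) (H : SimpleGraph W) (r : ℕ) (x : V) (y : W) : Prop :=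
  ∃ φ : G.induce (closedBall G x r) ≃g H.induce (closedBall H y r),
    φ ⟨x, self_mem_closedBall G x r⟩ = ⟨y, self_mem_closedBall H y r⟩

/-- Up to rooted isomorphism, `G` and `H` have the same set of rooted balls of radius `r`. -/
def SameBalls {V W : Type*} (G : SimpleGraph V) (H : SimpleGraph W) (r : ℕ) : Prop :=
  (∀ x : V, ∃ y : W, BallIso G H r x y) ∧ (∀ y : W, ∃ x : V, BallIso G H r x y)

/-- The distance `2 ^ (-n)`, where `n` is the largest integer such that `G` and `H` have the same
rooted balls of radius `i` for every `1 ≤ i ≤ n`; it is `0` if this holds for every `n`. -/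
noncomputable def ballDist {V W : Type*} (G : SimpleGraph V) (H : SimpleGraph W) : ℝ :=
  sInf {e : ℝ | ∃ n : ℕ, (∀ i : ℕ, 1 ≤ i → i ≤ n → SameBalls G H i) ∧ e = (1 / 2 : ℝ) ^ n}

/-- Topological convergence of graphs. -/
def ConvergesTopologically {V : ℕ → Type*} {W : Type*} (G : ∀ n, SimpleGraph (V n))
    (H : SimpleGraph W) : Prop :=
  Tendsto (fun n => ballDist (G n) H) atTop (𝓝 0)

section Laplacian

variable {V : Type*} (G : SimpleGraph V) [G.LocallyFinite]

/-- The graph Laplacian on arbitrary functions: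
`(Δ f)(x) = deg(x) f(x) - ∑_{y ∼ x} f(y)`. -/
noncomputable def lapFun (f : V → ℂ) (x : V) : ℂ :=
  (G.degree x : ℂ) * f x - ∑ y ∈ G.neighborFinset x, f y

theorem lapFun_bound {d : ℕ} (hd : ∀ x, G.degree x ≤ d) (f : lp (fun _ : V => ℂ) 2) :
    Summable (fun x => ‖lapFun G f x‖ ^ 2) ∧
      ∑' x, ‖lapFun G f x‖ ^ 2 ≤ (2 * d : ℝ) ^ 2 * ‖f‖ ^ 2 := by
  classical
  set a : V → ℝ := fun x => ‖f x‖ ^ 2 with ha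
  have ha0 : ∀ x, 0 ≤ a x := fun x => by positivity
  have hf : HasSum a (‖f‖ ^ 2) := by
    have h := lp.hasSum_norm (p := 2) (by norm_num) f
    simpa using h
  -- pointwise bound
  have hpt : ∀ x, ‖lapFun G f x‖ ^ 2 ≤
      2 * (d : ℝ) ^ 2 * a x + 2 * d * ∑ y ∈ G.neighborFinset x, a y := by
    intro x
    have hdx : (G.degree x : ℝ) ≤ d := by exact_mod_cast hd x
    have h1 : ‖lapFun G f x‖ ≤ d * ‖f x‖ + ∑ y ∈ G.neighborFinset x, ‖f y‖ := by
      refine (norm_sub_le _ _).trans (add_le_add ?_ (norm_sum_le _ _))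
      rw [norm_mul, Complex.norm_natCast]
      gcongr
    have h2 : (∑ y ∈ G.neighborFinset x, ‖f y‖) ^ 2 ≤ d * ∑ y ∈ G.neighborFinset x, a y := by
      refine (sq_sum_le_card_mul_sum_sq).trans ?_
      rw [G.card_neighborFinset_eq_degree]
      gcongr
    have h3 : ‖lapFun G f x‖ ^ 2 ≤ (d * ‖f x‖ + ∑ y ∈ G.neighborFinset x, ‖f y‖) ^ 2 := by
      gcongr
    have h4 : a x = ‖f x‖ ^ 2 := rfl
    nlinarith [sq_nonneg (d * ‖f x‖ - ∑ y ∈ G.neighborFinset x, ‖f y‖)]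
  -- double counting
  have hdc : ∀ s : Finset V, ∑ x ∈ s, ∑ y ∈ G.neighborFinset x, a y ≤ d * ‖f‖ ^ 2 := by
    intro s
    set t : Finset V := s.biUnion (fun x => G.neighborFinset x) with ht
    have e1 : ∑ x ∈ s, ∑ y ∈ G.neighborFinset x, a y
        = ∑ x ∈ s, ∑ y ∈ t, if G.Adj x y then a y else 0 := by
      refine Finset.sum_congr rfl fun x hx => ?_
      rw [← Finset.sum_filter]
      refine Finset.sum_congr ?_ fun _ _ => rfl
      ext y
      simp only [Finset.mem_filter, SimpleGraph.mem_neighborFinset, ht, Finset.mem_biUnion]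
      exact ⟨fun h => ⟨⟨x, hx, h⟩, h⟩, fun h => h.2⟩
    rw [e1, Finset.sum_comm]
    have e2 : ∀ y ∈ t, (∑ x ∈ s, if G.Adj x y then a y else 0) ≤ d * a y := by
      intro y _
      rw [← Finset.sum_filter, Finset.sum_const, nsmul_eq_mul]
      refine mul_le_mul_of_nonneg_right ?_ (ha0 y)
      have : (s.filter (fun x => G.Adj x y)) ⊆ G.neighborFinset y := by
        intro x hx
        simp only [Finset.mem_filter] at hx
        simpa using hx.2.symm
      have h5 := (Finset.card_le_card this).trans
        ((G.card_neighborFinset_eq_degree y).le.trans (hd y))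
      exact_mod_cast h5
    refine (Finset.sum_le_sum e2).trans ?_
    rw [← Finset.mul_sum]
    gcongr
    exact sum_le_hasSum t (fun i _ => ha0 i) hf
  have hfin : ∀ s : Finset V, ∑ x ∈ s, ‖lapFun G f x‖ ^ 2 ≤ (2 * d : ℝ) ^ 2 * ‖f‖ ^ 2 := by
    intro s
    refine (Finset.sum_le_sum fun x _ => hpt x).trans ?_
    rw [Finset.sum_add_distrib, ← Finset.mul_sum, ← Finset.mul_sum]
    have h6 : ∑ x ∈ s, a x ≤ ‖f‖ ^ 2 := sum_le_hasSum s (fun i _ => ha0 i) hf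
    have h7 := mul_le_mul_of_nonneg_left h6 (by positivity : (0 : ℝ) ≤ 2 * (d : ℝ) ^ 2)
    have h8 := mul_le_mul_of_nonneg_left (hdc s) (by positivity : (0 : ℝ) ≤ 2 * (d : ℝ))
    nlinarith
  have hs := summable_of_sum_le (fun x => by positivity) hfin
  exact ⟨hs, hs.tsum_le_of_sum_le hfin⟩

/-- The graph Laplacian as a linear map on `ℓ²(V)`, for a graph with degrees at most `d`. -/
noncomputable def lapLinear {d : ℕ} (hd : ∀ x, G.degree x ≤ d) :
    lp (fun _ : V => ℂ) 2 →ₗ[ℂ] lp (fun _ : V => ℂ) 2 where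
  toFun f := ⟨lapFun G f, memℓp_gen (by simpa using (lapFun_bound G hd f).1)⟩
  map_add' f g := by
    ext x
    simp only [lapFun, lp.coeFn_add, Pi.add_apply, Finset.sum_add_distrib]
    ring
  map_smul' c f := by
    ext x
    simp only [lapFun, lp.coeFn_smul, Pi.smul_apply, smul_eq_mul, RingHom.id_apply,
      ← Finset.mul_sum]
    ring

/-- The graph Laplacian `Δ_G : ℓ²(V) → ℓ²(V)`, a bounded operator for a graph with degrees at
most `d`. -/
noncomputable def laplacian {d : ℕ} (hd : ∀ x, G.degree x ≤ d) :
    lp (fun _ : V => ℂ) 2 →L[ℂ] lp (fun _ : V => ℂ) 2 :=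
  (lapLinear G hd).mkContinuous (2 * d) fun f => by
    have h := lp.norm_rpow_eq_tsum (p := 2) (by norm_num) (lapLinear G hd f)
    have h' : ‖lapLinear G hd f‖ ^ 2 = ∑' x, ‖lapFun G f x‖ ^ 2 := by
      simp only [ENNReal.toReal_ofNat, Real.rpow_ofNat] at h
      exact h
    refine le_of_sq_le_sq ?_ (by positivity)
    rw [h', mul_pow]
    exact (lapFun_bound G hd f).2

/-- The spectrum of the graph Laplacian. -/
def spec {d : ℕ} (hd : ∀ x, G.degree x ≤ d) : Set ℂ :=
  spectrum ℂ (laplacian G hd)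

end Laplacian

end GraphSpec

/-! For a self-adjoint operator, a nonzero f with ‖(Δ - z)f‖ < ε‖f‖ puts z within ε of the spectrum,
and every spectral point admits such f for every ε > 0. It therefore suffices to carry approximate
eigenvectors from one graph to the other. One supported in a ball can be carried along a rooted
isomorphism of slightly larger balls (`BallIso.exists_transfer`).

The crux is localization to a ball of controlled radius (`IsDoubling.exists_localized`). Multiply f
by cutoffs χ_x, equal to 1 on B_R(x), zero off B_{2R}(x) and of slope 1/R, and sum over all centres
x with weight 1/|B_R(x)|. By doubling, the weighted sum of ‖χ_x f‖² is at least ‖f‖²/D, while that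
of ‖(Δ - z)(χ_x f)‖² is at most D³(2‖(Δ - z)f‖² + 2d²‖f‖²/R²). Hence some χ_x f is still an
approximate eigenvector, with R depending only on ε, d and D. The limit graph is doubling too, so
the argument runs in both directions. -/

namespace GraphSpec

/-! ### Spectrum and approximate eigenvectors of self-adjoint operators -/

section Hilbert

variable {E : Type*} [NormedAddCommGroup E] [InnerProductSpace ℂ E] [CompleteSpace E]

/-- Otherwise T - z is bounded below. Since z is real, T - z is self-adjoint, so its trivial kernel
forces dense range and it is invertible. The strict inequality also forces f ≠ 0. -/
theorem exists_approx_eigenvector {T : E →L[ℂ] E} (hT : IsSelfAdjoint T) {z : ℂ}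
    (hz : z ∈ spectrum ℂ T) {δ : ℝ} (hδ : 0 < δ) : ∃ f : E, ‖T f - z • f‖ < δ * ‖f‖ := by
  by_contra! hcon
  set S : E →L[ℂ] E := T - algebraMap ℂ (E →L[ℂ] E) z with hS
  have hSa : ∀ f, S f = T f - z • f := fun f => by
    simp [hS, Algebra.algebraMap_eq_smul_one]
  have hSsa : IsSelfAdjoint S := by
    have hz' := hT.mem_spectrum_eq_re hz
    refine hT.sub ?_
    rw [hz', IsSelfAdjoint, ← algebraMap_star_comm]
    simp
  have hanti : AntilipschitzWith (Real.toNNReal δ⁻¹) S := by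
    refine S.antilipschitz_of_bound fun f => ?_
    rw [hSa, Real.coe_toNNReal _ (by positivity)]
    have := hcon f
    rw [inv_mul_eq_div, le_div_iff₀ hδ]
    linarith
  have hker : S.ker = ⊥ := LinearMap.ker_eq_bot.2 hanti.injective
  have hbij : Function.Bijective S := by
    rw [ContinuousLinearMap.bijective_iff_dense_range_and_antilipschitz]
    refine ⟨?_, _, hanti⟩
    rw [Submodule.topologicalClosure_eq_top_iff, ContinuousLinearMap.orthogonal_range,
      hSsa.adjoint_eq, hker]
  have hu : IsUnit S := ContinuousLinearMap.isUnit_iff_bijective.2 hbij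
  exact spectrum.mem_iff.1 hz (by rw [← neg_sub]; exact hu.neg)

/-- The resolvent at z is normal, so its norm is its spectral radius, at most 1/ε if the spectrum of
T stays farther than ε from z. -/
theorem exists_mem_spectrum_near {T : E →L[ℂ] E} (hT : IsSelfAdjoint T) {z : ℂ} {ε : ℝ}
    (hε : 0 < ε) {f : E} (hf : f ≠ 0) (h : ‖T f - z • f‖ < ε * ‖f‖) :
    ∃ w ∈ spectrum ℂ T, ‖z - w‖ ≤ ε := by
  by_contra! hcon
  have hfpos : 0 < ‖f‖ := norm_pos_iff.2 hf
  by_cases hz : z ∈ spectrum ℂ T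
  · have := hcon z hz
    simp only [sub_self, norm_zero] at this
    linarith
  rw [spectrum.notMem_iff] at hz
  obtain ⟨u, hu⟩ := hz
  have hnormal : IsStarNormal (↑u⁻¹ : E →L[ℂ] E) := by
    have : IsStarNormal (u : E →L[ℂ] E) := by
      rw [hu, isStarNormal_iff, star_sub, hT.star_eq, ← algebraMap_star_comm]
      have hc : ∀ (a : ℂ) (S : E →L[ℂ] E), Commute (algebraMap ℂ (E →L[ℂ] E) a) S :=
        Algebra.commutes
      exact ((hc _ _).sub_right (hc _ _)).sub_left ((hc _ _).symm.sub_right (Commute.refl T))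
    infer_instance
  have hnorm : ‖(↑u⁻¹ : E →L[ℂ] E)‖ ≤ ε⁻¹ := by
    have h1 := IsStarNormal.spectralRadius_eq_nnnorm (↑u⁻¹ : E →L[ℂ] E)
    have h2 : spectralRadius ℂ (↑u⁻¹ : E →L[ℂ] E) ≤ ENNReal.ofReal ε⁻¹ := by
      refine iSup₂_le fun k hk => ?_
      -- Spectral mapping: k⁻¹ = z - w for some w in the spectrum of T.
      rw [← spectrum.map_inv, Set.mem_inv, hu, ← spectrum.singleton_sub_eq] at hk
      obtain ⟨_, rfl, w, hw, hk⟩ := hk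
      have := hcon w hw
      dsimp only at hk
      rw [hk, norm_inv] at this
      have hk0 : 0 < ‖k‖ := inv_pos.1 (hε.trans this)
      rw [ENNReal.ofReal, ENNReal.coe_le_coe, ← NNReal.coe_le_coe, coe_nnnorm,
        Real.coe_toNNReal _ (by positivity)]
      exact ((lt_inv_comm₀ hε hk0).1 this).le
    rw [h1, ENNReal.ofReal, ENNReal.coe_le_coe, ← NNReal.coe_le_coe, coe_nnnorm,
      Real.coe_toNNReal _ (by positivity)] at h2
    exact h2
  have h3 : f = (↑u⁻¹ : E →L[ℂ] E) ((u : E →L[ℂ] E) f) := by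
    rw [← mul_apply_eq_comp, Units.inv_mul]; rfl
  have h4 : ‖f‖ ≤ ε⁻¹ * ‖(u : E →L[ℂ] E) f‖ := by
    conv_lhs => rw [h3]
    exact ((↑u⁻¹ : E →L[ℂ] E).le_opNorm _).trans (by gcongr)
  have h5 : (u : E →L[ℂ] E) f = -(T f - z • f) := by
    rw [hu]; simp [Algebra.algebraMap_eq_smul_one]
  rw [h5, norm_neg, inv_mul_eq_div, le_div_iff₀ hε] at h4
  linarith

end Hilbert

/-! ### Balls and their rooted isomorphisms -/

section Balls

variable {V W : Type*} {G : SimpleGraph V} {H : SimpleGraph W}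

theorem mem_closedBall {x y : V} {r : ℕ} : y ∈ closedBall G x r ↔ G.edist x y ≤ r := Iff.rfl

theorem mem_closedBall_comm {x y : V} {r : ℕ} : y ∈ closedBall G x r ↔ x ∈ closedBall G y r := by
  rw [mem_closedBall, mem_closedBall, SimpleGraph.edist_comm]

theorem closedBall_mono (x : V) {r s : ℕ} (h : r ≤ s) : closedBall G x r ⊆ closedBall G x s :=
  fun _ hy => le_trans (mem_closedBall.1 hy) (Nat.cast_le.2 h)

theorem closedBall_trans {x y z : V} {r s t : ℕ} (hy : y ∈ closedBall G x r)
    (hz : z ∈ closedBall G y s) (h : r + s ≤ t) : z ∈ closedBall G x t := by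
  refine SimpleGraph.edist_triangle.trans ((add_le_add hy hz).trans ?_)
  exact_mod_cast h

theorem mem_closedBall_of_adj {x y z : V} {r s : ℕ} (hy : y ∈ closedBall G x r)
    (hz : G.Adj y z) (h : r + 1 ≤ s) : z ∈ closedBall G x s :=
  closedBall_trans hy (by simp [mem_closedBall, SimpleGraph.edist_eq_one_iff_adj.2 hz]) h

theorem closedBall_zero (x : V) : closedBall G x 0 = {x} := by
  ext y
  rw [mem_closedBall, Nat.cast_zero, nonpos_iff_eq_zero, SimpleGraph.edist_eq_zero_iff,
    Set.mem_singleton_iff, eq_comm]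

theorem mem_closedBall_succ {x y : V} {r : ℕ} (hy : y ∈ closedBall G x (r + 1)) :
    y = x ∨ ∃ u ∈ closedBall G x r, G.Adj u y := by
  rw [mem_closedBall_comm] at hy
  obtain ⟨p, hp⟩ := SimpleGraph.exists_walk_of_edist_ne_top
    (ne_top_of_le_ne_top (ENat.natCast_ne_top (r + 1)) hy)
  cases p with
  | nil => exact Or.inl rfl
  | @cons _ v _ h q =>
    refine Or.inr ⟨v, ?_, h.symm⟩
    rw [mem_closedBall_comm]
    refine (SimpleGraph.edist_le q).trans ?_
    have h1 : ((q.length + 1 : ℕ) : ℕ∞) ≤ ((r + 1 : ℕ) : ℕ∞) := by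
      rw [← SimpleGraph.Walk.length_cons h q, hp]; exact hy
    have h2 : q.length + 1 ≤ r + 1 := by exact_mod_cast h1
    exact_mod_cast Nat.le_of_succ_le_succ h2

theorem closedBall_finite [G.LocallyFinite] (x : V) (r : ℕ) : (closedBall G x r).Finite := by
  induction r with
  | zero => simp [closedBall_zero]
  | succ r ih =>
    refine ((ih.biUnion fun u _ => (G.neighborFinset u).finite_toSet).insert x).subset ?_
    intro y hy
    rcases mem_closedBall_succ hy with rfl | ⟨u, hu, hadj⟩
    · exact Set.mem_insert _ _
    · exact Set.mem_insert_of_mem _ (Set.mem_biUnion hu (by simpa using hadj))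

theorem BallIso.symm {r : ℕ} {x : V} {y : W} (h : BallIso G H r x y) : BallIso H G r y x := by
  obtain ⟨φ, hφ⟩ := h
  exact ⟨φ.symm, by rw [← hφ]; simp⟩

theorem SameBalls.symm {r : ℕ} (h : SameBalls G H r) : SameBalls H G r :=
  ⟨fun y => (h.2 y).imp fun _ hx => hx.symm, fun x => (h.1 x).imp fun _ hy => hy.symm⟩

/-- A shortest path from the root to a point of the ball stays in the ball, so the induced subgraph
already determines distances to the root; the induction follows such a path. -/
theorem iso_mem_closedBall {r : ℕ} {x : V} {y : W}
    (φ : G.induce (closedBall G x r) ≃g H.induce (closedBall H y r))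
    (hφ : φ ⟨x, self_mem_closedBall G x r⟩ = ⟨y, self_mem_closedBall H y r⟩)
    {s : ℕ} (hs : s ≤ r) (v : closedBall G x r) (hv : (v : V) ∈ closedBall G x s) :
    (φ v : W) ∈ closedBall H y s := by
  induction s generalizing v with
  | zero =>
    rw [closedBall_zero, Set.mem_singleton_iff] at hv
    have : v = ⟨x, self_mem_closedBall G x r⟩ := Subtype.ext hv
    rw [this, hφ]
    exact self_mem_closedBall _ _ _
  | succ s ih =>
    rcases mem_closedBall_succ hv with h | ⟨u, hu, hadj⟩
    · have : v = ⟨x, self_mem_closedBall G x r⟩ := Subtype.ext h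
      rw [this, hφ]
      exact self_mem_closedBall _ _ _
    · have hur := closedBall_mono (G := G) x (by omega : s ≤ r) hu
      have h1 := ih (by omega) ⟨u, hur⟩ hu
      have h2 : (H.induce (closedBall H y r)).Adj (φ ⟨u, hur⟩) (φ v) :=
        φ.map_rel_iff.2 (by simpa using hadj)
      exact mem_closedBall_of_adj h1 (by simpa using h2) le_rfl

theorem iso_mem_closedBall_iff {r : ℕ} {x : V} {y : W}
    (φ : G.induce (closedBall G x r) ≃g H.induce (closedBall H y r))
    (hφ : φ ⟨x, self_mem_closedBall G x r⟩ = ⟨y, self_mem_closedBall H y r⟩)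
    {s : ℕ} (hs : s ≤ r) (v : closedBall G x r) :
    (φ v : W) ∈ closedBall H y s ↔ (v : V) ∈ closedBall G x s := by
  refine ⟨fun h => ?_, iso_mem_closedBall φ hφ hs v⟩
  have := iso_mem_closedBall φ.symm (by rw [← hφ]; simp) hs (φ v) h
  simpa using this

theorem BallIso.encard_le {r s : ℕ} {x : V} {y : W} (h : BallIso G H r x y) (hs : s ≤ r) :
    (closedBall G x s).encard ≤ (closedBall H y s).encard := by
  classical
  obtain ⟨φ, hφ⟩ := h
  refine Set.encard_le_encard_of_injOn
    (f := fun v => if h : v ∈ closedBall G x r then (φ ⟨v, h⟩ : W) else y) ?_ ?_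
  · intro v hv
    have hvr := closedBall_mono x hs hv
    simpa [hvr] using iso_mem_closedBall φ hφ hs ⟨v, hvr⟩ hv
  · intro v hv w hw hvw
    have hvr := closedBall_mono x hs hv
    have hwr := closedBall_mono x hs hw
    simpa [hvr, hwr, Subtype.ext_iff.symm] using hvw

theorem BallIso.encard_eq {r s : ℕ} {x : V} {y : W} (h : BallIso G H r x y) (hs : s ≤ r) :
    (closedBall G x s).encard = (closedBall H y s).encard :=
  le_antisymm (h.encard_le hs) (h.symm.encard_le hs)

end Balls

/-! ### Consequences of topological convergence -/

theorem ConvergesTopologically.eventually_sameBalls {V : ℕ → Type*} {W : Type*}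
    {G : ∀ n, SimpleGraph (V n)} {H : SimpleGraph W} (h : ConvergesTopologically G H) {r : ℕ}
    (hr : 1 ≤ r) : ∀ᶠ n in atTop, SameBalls (G n) H r := by
  have h1 : ∀ᶠ n in atTop, ballDist (G n) H < (1 / 2 : ℝ) ^ r :=
    h.eventually_lt_const (by positivity)
  filter_upwards [h1] with n hn
  -- The exponent 0 is always admissible, so the infimum is over a nonempty set; a member below
  -- (1/2)^r has exponent above r.
  obtain ⟨_, ⟨m, hm, rfl⟩, hlt⟩ := exists_lt_of_csInf_lt
    (s := {e : ℝ | ∃ n' : ℕ, (∀ i : ℕ, 1 ≤ i → i ≤ n' → SameBalls (G n) H i) ∧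
      e = (1 / 2 : ℝ) ^ n'}) ⟨1, ⟨0, fun i h1 h0 => absurd h1 (by omega), by simp⟩⟩ hn
  exact hm r hr ((pow_lt_pow_iff_right_of_lt_one₀ (by norm_num) (by norm_num)).1 hlt).le

/-- Doubling at scale s is visible in balls of radius 2s, each of which already occurs in some `G
n`. -/
theorem ConvergesTopologically.isDoubling {V : ℕ → Type*} {W : Type*}
    {G : ∀ n, SimpleGraph (V n)} {H : SimpleGraph W} (h : ConvergesTopologically G H) {D : ℕ}
    (hG : ∀ n, IsDoubling (G n) D) : IsDoubling H D := by
  intro y s hs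
  obtain ⟨n, hn⟩ := (h.eventually_sameBalls (r := 2 * s) (by omega)).exists
  obtain ⟨x, hx⟩ := hn.2 y
  rw [← hx.encard_eq le_rfl, ← hx.encard_eq (by omega : s ≤ 2 * s)]
  exact hG n x s hs

/-- The squared `ℓ²` norm of an arbitrary function, with values in `[0, ∞]`. -/
noncomputable def sqNorm {V : Type*} (f : V → ℂ) : ℝ≥0∞ := ∑' x, ‖f x‖ₑ ^ 2

/-- The function `(Δ - z) f`. -/
noncomputable def lapShift {V : Type*} (G : SimpleGraph V) [G.LocallyFinite] (z : ℂ) (f : V → ℂ)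
    (x : V) : ℂ := lapFun G f x - z * f x

theorem sqNorm_coe {V : Type*} (f : lp (fun _ : V => ℂ) 2) :
    sqNorm (f : V → ℂ) = ENNReal.ofReal (‖f‖ ^ 2) := by
  have h := lp.hasSum_norm (p := 2) (by norm_num) f
  simp only [ENNReal.toReal_ofNat, Real.rpow_ofNat] at h
  rw [← h.tsum_eq, ENNReal.ofReal_tsum_of_nonneg (fun _ => by positivity) h.summable]
  refine tsum_congr fun x => ?_
  rw [ENNReal.ofReal_pow (norm_nonneg _), ofReal_norm]

/-! ### Self-adjointness of the Laplacian -/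

section Laplacian

variable {V : Type*} {G : SimpleGraph V} [G.LocallyFinite] {d : ℕ} (hd : ∀ x, G.degree x ≤ d)

theorem laplacian_apply (f : lp (fun _ : V => ℂ) 2) (x : V) :
    laplacian G hd f x = lapFun G f x := rfl

theorem coe_laplacian_sub (z : ℂ) (f : lp (fun _ : V => ℂ) 2) :
    ((laplacian G hd f - z • f : lp (fun _ : V => ℂ) 2) : V → ℂ) = lapShift G z f := by
  rfl

theorem laplacian_single [DecidableEq V] (x : V) :
    laplacian G hd (lp.single 2 x (1 : ℂ)) = (G.degree x : ℂ) • lp.single 2 x (1 : ℂ) -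
      ∑ y ∈ G.neighborFinset x, lp.single 2 y (1 : ℂ) := by
  ext v
  rw [laplacian_apply, lp.coeFn_sub, Pi.sub_apply, lp.coeFn_smul, Pi.smul_apply, lp.coeFn_sum,
    Finset.sum_apply, lapFun]
  simp only [lp.single_apply, Pi.single_apply, smul_eq_mul, Finset.sum_ite_eq,
    Finset.sum_ite_eq', SimpleGraph.mem_neighborFinset, G.adj_comm]
  by_cases h : v = x
  · subst h; simp
  · have : x ∈ G.neighborFinset v ↔ v ∈ G.neighborFinset x := by simp [G.adj_comm]
    simpa [h] using if_congr this rfl rfl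

/-- Pairing with point masses suffices: (Δ* f)(x) = ⟨δ_x, Δ* f⟩ = ⟨Δ δ_x, f⟩ = (Δ f)(x). -/
theorem laplacian_isSelfAdjoint : IsSelfAdjoint (laplacian G hd) := by
  classical
  rw [ContinuousLinearMap.isSelfAdjoint_iff']
  ext f x
  have h := lp.inner_single_left (𝕜 := ℂ) x (1 : ℂ) (ContinuousLinearMap.adjoint (laplacian G hd) f)
  rw [ContinuousLinearMap.adjoint_inner_right, laplacian_single, inner_sub_left, inner_smul_left,
    sum_inner] at h
  simp only [lp.inner_single_left] at h
  simp only [RCLike.inner_apply, map_one, mul_one, map_natCast] at h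
  rw [laplacian_apply, lapFun, ← h]

end Laplacian

/-! ### Transfer of finitely supported functions between isomorphic balls -/

section Transfer

variable {V W : Type*} {G : SimpleGraph V} {H : SimpleGraph W}

theorem sqNorm_eq_of_iso {r : ℕ} {x : V} {y : W}
    (φ : G.induce (closedBall G x r) ≃g H.induce (closedBall H y r)) {f : V → ℂ} {g : W → ℂ}
    (hf : ∀ v ∉ closedBall G x r, f v = 0) (hg : ∀ w ∉ closedBall H y r, g w = 0)
    (hfg : ∀ v, g (φ v) = f v) : sqNorm g = sqNorm f := by
  have h1 : sqNorm f = ∑' v : closedBall G x r, ‖f v‖ₑ ^ 2 := by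
    refine (tsum_subtype_eq_of_support_subset (f := fun v => ‖f v‖ₑ ^ 2) ?_).symm
    intro v hv
    by_contra hcon
    exact hv (by simp [hf v hcon])
  have h2 : sqNorm g = ∑' w : closedBall H y r, ‖g w‖ₑ ^ 2 := by
    refine (tsum_subtype_eq_of_support_subset (f := fun v => ‖g v‖ₑ ^ 2) ?_).symm
    intro v hv
    by_contra hcon
    exact hv (by simp [hg v hcon])
  rw [h1, h2, ← φ.toEquiv.tsum_eq]
  exact tsum_congr fun v => by rw [← hfg v]; rfl

variable [G.LocallyFinite] [H.LocallyFinite]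

theorem sum_neighborFinset_of_iso {r : ℕ} {x : V} {y : W}
    (φ : G.induce (closedBall G x (r + 1)) ≃g H.induce (closedBall H y (r + 1)))
    (hφ : φ ⟨x, self_mem_closedBall G x (r + 1)⟩ = ⟨y, self_mem_closedBall H y (r + 1)⟩)
    {f : V → ℂ} {g : W → ℂ} (hfg : ∀ v, g (φ v) = f v) (v : closedBall G x (r + 1))
    (hv : (v : V) ∈ closedBall G x r) :
    ∑ u ∈ G.neighborFinset v, f u = ∑ u ∈ H.neighborFinset (φ v), g u := by
  have hmem : ∀ u ∈ G.neighborFinset v, u ∈ closedBall G x (r + 1) := fun u hu =>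
    mem_closedBall_of_adj hv (by simpa using hu) le_rfl
  have hmem' : ∀ u ∈ H.neighborFinset (φ v), u ∈ closedBall H y (r + 1) := fun u hu =>
    mem_closedBall_of_adj (iso_mem_closedBall φ hφ (by omega) v hv) (by simpa using hu) le_rfl
  refine Finset.sum_bij (fun u hu => (φ ⟨u, hmem u hu⟩ : W)) ?_ ?_ ?_ ?_
  · intro u hu
    have h2 : (H.induce (closedBall H y (r + 1))).Adj (φ v) (φ ⟨u, hmem u hu⟩) :=
      φ.map_rel_iff.2 (by simpa using hu)
    simpa using h2
  · intro u hu u' hu' h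
    have := φ.injective (Subtype.ext h)
    simpa using this
  · intro w hw
    have h2 : (G.induce (closedBall G x (r + 1))).Adj v (φ.symm ⟨w, hmem' w hw⟩) := by
      rw [← φ.map_rel_iff]
      simpa using hw
    exact ⟨φ.symm ⟨w, hmem' w hw⟩, by simpa using h2, by simp⟩
  · intro u hu
    exact (hfg ⟨u, _⟩).symm

theorem lapShift_eq_of_iso {r : ℕ} {x : V} {y : W}
    (φ : G.induce (closedBall G x (r + 1)) ≃g H.induce (closedBall H y (r + 1)))
    (hφ : φ ⟨x, self_mem_closedBall G x (r + 1)⟩ = ⟨y, self_mem_closedBall H y (r + 1)⟩)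
    {f : V → ℂ} {g : W → ℂ} (hfg : ∀ v, g (φ v) = f v) (z : ℂ) (v : closedBall G x (r + 1))
    (hv : (v : V) ∈ closedBall G x r) : lapShift H z g (φ v) = lapShift G z f v := by
  -- Summing the constant function 1 over neighbours shows that the degrees agree.
  have h1 := sum_neighborFinset_of_iso φ hφ (f := 1) (g := 1) (by simp) v hv
  have h2 := sum_neighborFinset_of_iso φ hφ hfg v hv
  simp only [Pi.one_apply, Finset.sum_const, SimpleGraph.card_neighborFinset_eq_degree,
    nsmul_eq_mul, mul_one] at h1
  rw [lapShift, lapShift, lapFun, lapFun, hfg, h1, h2]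

theorem lapShift_eq_zero {r : ℕ} {x : V} {f : V → ℂ} (hf : ∀ v ∉ closedBall G x r, f v = 0)
    (z : ℂ) {v : V} (hv : v ∉ closedBall G x (r + 1)) : lapShift G z f v = 0 := by
  have h1 : f v = 0 := hf v fun h => hv (closedBall_mono x (by omega) h)
  have h2 : ∑ u ∈ G.neighborFinset v, f u = 0 := Finset.sum_eq_zero fun u hu =>
    hf u fun h => hv (mem_closedBall_of_adj h (by simpa using (G.adj_symm (by simpa using hu) :
      G.Adj u v)) le_rfl)
  simp [lapShift, lapFun, h1, h2]

/-- The two extra units of radius: (Δ - z)f lives on B_{r+1}, and its values there involve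
neighbours in B_{r+2}. -/
theorem BallIso.exists_transfer {r : ℕ} {x : V} {y : W} (h : BallIso G H (r + 2) x y) (z : ℂ)
    {f : V → ℂ} (hf : ∀ v ∉ closedBall G x r, f v = 0) :
    ∃ g : W → ℂ, (∀ w ∉ closedBall H y r, g w = 0) ∧ sqNorm g = sqNorm f ∧
      sqNorm (lapShift H z g) = sqNorm (lapShift G z f) := by
  classical
  obtain ⟨φ, hφ⟩ := h
  set g : W → ℂ := fun w =>
    if h : w ∈ closedBall H y (r + 2) then f (φ.symm ⟨w, h⟩) else 0 with hg
  have hfg : ∀ v, g (φ v) = f v := fun v => by simp [hg]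
  have hg0 : ∀ w ∉ closedBall H y r, g w = 0 := by
    intro w hw
    by_cases hw2 : w ∈ closedBall H y (r + 2)
    · simp only [hg, hw2, dite_true]
      refine hf _ fun h => hw ?_
      rw [← iso_mem_closedBall_iff φ hφ (by omega)] at h
      simpa using h
    · simp [hg, hw2]
  refine ⟨g, hg0, sqNorm_eq_of_iso φ (fun v hv => hf v fun h => hv (closedBall_mono x (by omega) h))
    (fun v hv => hg0 v fun h => hv (closedBall_mono y (by omega) h)) hfg,
    sqNorm_eq_of_iso φ (fun v hv => lapShift_eq_zero hf z fun h => hv (closedBall_mono x (by omega) h))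
    (fun v hv => lapShift_eq_zero hg0 z fun h => hv (closedBall_mono y (by omega) h)) fun v => ?_⟩
  by_cases hv : (v : V) ∈ closedBall G x (r + 1)
  · exact lapShift_eq_of_iso φ hφ hfg z v hv
  · rw [lapShift_eq_zero hf z hv, lapShift_eq_zero hg0 z]
    rwa [iso_mem_closedBall_iff φ hφ (by omega)]

end Transfer

/-! ### Localization by averaged cutoffs -/

section Localization

variable {V : Type*} {G : SimpleGraph V}

/-- The indicator of the ball `B_r(G, x)`. -/
noncomputable def ballInd (G : SimpleGraph V) (r : ℕ) (x y : V) : ℝ≥0∞ :=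
  (closedBall G x r).indicator 1 y

theorem ballInd_comm (r : ℕ) (x y : V) : ballInd G r x y = ballInd G r y x := by
  classical
  simp only [ballInd, Set.indicator_apply, mem_closedBall_comm (x := x), Pi.one_apply]

/-- The number of vertices of `B_r(G, x)`. -/
noncomputable def vol (G : SimpleGraph V) (r : ℕ) (x : V) : ℝ≥0∞ :=
  ((closedBall G x r).encard : ℝ≥0∞)

theorem tsum_ballInd (r : ℕ) (x : V) : ∑' y, ballInd G r x y = vol G r x := by
  rw [vol, ← ENNReal.tsum_set_one, tsum_subtype (closedBall G x r) (fun _ => (1 : ℝ≥0∞))]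
  rfl

theorem vol_ne_zero (r : ℕ) (x : V) : vol G r x ≠ 0 := by
  have : (closedBall G x r).encard ≠ 0 :=
    Set.encard_ne_zero.2 ⟨x, self_mem_closedBall G x r⟩
  simpa [vol] using this

theorem vol_mono {r s : ℕ} {x y : V} (h : closedBall G x r ⊆ closedBall G y s) :
    vol G r x ≤ vol G s y := by
  simpa [vol] using Set.encard_le_encard h

theorem IsDoubling.vol_le {D : ℕ} (hG : IsDoubling G D) {s : ℕ} (hs : 1 ≤ s) (x : V) :
    vol G (2 * s) x ≤ D * vol G s x := by
  have h := ENat.toENNReal_le.2 (hG x s hs)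
  simpa [vol] using h

theorem inv_le_mul_inv_of_le_mul {a b c : ℝ≥0∞} (hb : b ≠ 0) (hb' : b ≠ ⊤) (ha : a ≠ 0)
    (ha' : a ≠ ⊤) (h : a ≤ c * b) : b⁻¹ ≤ c * a⁻¹ := by
  calc b⁻¹ = a * (b⁻¹ * a⁻¹) := by
        rw [mul_left_comm, ENNReal.mul_inv_cancel ha ha', mul_one]
    _ ≤ c * b * (b⁻¹ * a⁻¹) := by gcongr
    _ = c * a⁻¹ := by
        rw [mul_assoc, ← mul_assoc b, ENNReal.mul_inv_cancel hb hb', one_mul]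

/-- A function that is `1` on `B_R(G, x)`, vanishes outside `B_{2R}(G, x)` and changes by at most
`1 / R` along each edge. -/
noncomputable def cutoff (G : SimpleGraph V) (R : ℕ) (x y : V) : ℝ :=
  (∑ k ∈ Finset.range R, (closedBall G x (R + k)).indicator 1 y) / R

theorem cutoff_eq_one {R : ℕ} (hR : 1 ≤ R) {x y : V} (hy : y ∈ closedBall G x R) :
    cutoff G R x y = 1 := by
  have hR' : (R : ℝ) ≠ 0 := by positivity
  rw [cutoff, Finset.sum_congr rfl fun k _ => Set.indicator_of_mem
    (closedBall_mono x (by omega : R ≤ R + k) hy) _]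
  simp [hR']

theorem cutoff_eq_zero {R : ℕ} {x y : V} (hy : y ∉ closedBall G x (2 * R)) :
    cutoff G R x y = 0 := by
  rw [cutoff, Finset.sum_eq_zero, zero_div]
  intro k hk
  rw [Finset.mem_range] at hk
  exact Set.indicator_of_notMem (fun h => hy (closedBall_mono x (by omega) h)) _

theorem cutoff_nonneg (R : ℕ) (x y : V) : 0 ≤ cutoff G R x y :=
  div_nonneg (Finset.sum_nonneg fun _ _ => Set.indicator_nonneg (fun _ _ => zero_le_one) _)
    (Nat.cast_nonneg R)

theorem cutoff_le_one (R : ℕ) (x y : V) : cutoff G R x y ≤ 1 := by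
  refine div_le_one_of_le₀ ?_ (Nat.cast_nonneg R)
  refine (Finset.sum_le_sum fun k _ => Set.indicator_le_self' (s := closedBall G x (R + k))
    (fun _ _ => zero_le_one) y).trans ?_
  simp

/-- Crossing an edge shifts the radius by at most one, so the two sums of indicators differ by at
most one boundary term. -/
theorem cutoff_le_of_adj {R : ℕ} {x y z : V} (h : G.Adj y z) :
    cutoff G R x z ≤ cutoff G R x y + 1 / R := by
  rw [cutoff, cutoff, ← add_div]
  gcongr
  set a : ℕ → ℝ := fun k => (closedBall G x (R + k)).indicator 1 y with ha
  have h1 : ∀ k ∈ Finset.range R, (closedBall G x (R + k)).indicator (1 : V → ℝ) z ≤ a (k + 1) := by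
    intro k _
    by_cases hz : z ∈ closedBall G x (R + k)
    · have hy : y ∈ closedBall G x (R + (k + 1)) := mem_closedBall_of_adj hz h.symm (by omega)
      simp [ha, hz, hy]
    · rw [Set.indicator_of_notMem hz]
      exact Set.indicator_nonneg (fun _ _ => zero_le_one) _
  have h2 := Finset.sum_range_succ a R
  have h3 := Finset.sum_range_succ' a R
  have h4 : a R ≤ 1 := Set.indicator_le_self' (s := closedBall G x (R + R))
    (fun _ _ => zero_le_one) y
  have h5 : 0 ≤ a 0 := Set.indicator_nonneg (fun _ _ => zero_le_one) _
  have h6 := Finset.sum_le_sum h1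
  linarith

/-- The difference vanishes unless z ∈ B_{2R+1}(x). The larger radius 4R is chosen as a power of two
times R, to suit doubling. -/
theorem cutoff_sub_sq_le {R : ℕ} (hR : 1 ≤ R) {x y z : V} (h : G.Adj y z) :
    (cutoff G R x y - cutoff G R x z) ^ 2 ≤
      (closedBall G x (4 * R)).indicator 1 z / (R : ℝ) ^ 2 := by
  by_cases hz : z ∈ closedBall G x (4 * R)
  · rw [Set.indicator_of_mem hz, Pi.one_apply, ← one_div_pow, sq_le_sq,
      abs_of_nonneg (by positivity : (0 : ℝ) ≤ 1 / R), abs_sub_le_iff]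
    have h1 := cutoff_le_of_adj (R := R) (x := x) h
    have h2 := cutoff_le_of_adj (R := R) (x := x) h.symm
    constructor <;> linarith
  · rw [cutoff_eq_zero fun hy => hz (mem_closedBall_of_adj hy h (by omega)),
      cutoff_eq_zero fun hz' => hz (closedBall_mono x (by omega) hz')]
    simp [hz]

theorem cutoff_sq_le {R : ℕ} (x y : V) :
    cutoff G R x y ^ 2 ≤ (closedBall G x (4 * R)).indicator 1 y := by
  by_cases hy : y ∈ closedBall G x (4 * R)
  · rw [Set.indicator_of_mem hy, Pi.one_apply]
    exact pow_le_one₀ (cutoff_nonneg R x y) (cutoff_le_one R x y)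
  · rw [cutoff_eq_zero fun hy' => hy (closedBall_mono x (by omega) hy')]
    simp [hy]

theorem ofReal_indicator_mul (r : ℕ) (x y : V) (a : ℂ) :
    ENNReal.ofReal ((closedBall G x r).indicator 1 y * ‖a‖ ^ 2) =
      ballInd G r x y * ‖a‖ₑ ^ 2 := by
  by_cases hy : y ∈ closedBall G x r
  · simp [ballInd, hy, ENNReal.ofReal_pow]
  · simp [ballInd, hy]

variable [G.LocallyFinite]

theorem vol_ne_top (r : ℕ) (x : V) : vol G r x ≠ ⊤ := by
  simpa [vol] using (closedBall_finite (G := G) x r)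

/-- If x is within 4R of y, then B_{4R}(y) ⊆ B_{8R}(x), and three doublings bound 1/|B_R(x)| by
D³/|B_{4R}(y)|. There are |B_{4R}(y)| such x. -/
theorem tsum_weight_le {D : ℕ} (hG : IsDoubling G D) {R : ℕ} (hR : 1 ≤ R) (y : V) :
    ∑' x, (vol G R x)⁻¹ * ballInd G (4 * R) x y ≤ (D : ℝ≥0∞) ^ 3 := by
  have h1 : ∀ x, (vol G R x)⁻¹ * ballInd G (4 * R) x y ≤
      (D : ℝ≥0∞) ^ 3 * (vol G (4 * R) y)⁻¹ * ballInd G (4 * R) y x := by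
    intro x
    rw [ballInd_comm]
    by_cases hx : x ∈ closedBall G y (4 * R)
    · gcongr
      refine inv_le_mul_inv_of_le_mul (vol_ne_zero _ _) (vol_ne_top _ _) (vol_ne_zero _ _)
        (vol_ne_top _ _) ?_
      calc vol G (4 * R) y ≤ vol G (2 * (2 * (2 * R))) x :=
            vol_mono fun z hz => closedBall_trans (mem_closedBall_comm.1 hx) hz (by omega)
        _ ≤ D * (D * (D * vol G R x)) := by
            refine (hG.vol_le (by omega) x).trans ?_
            gcongr
            refine (hG.vol_le (by omega) x).trans ?_
            gcongr
            exact hG.vol_le hR x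
        _ = D ^ 3 * vol G R x := by ring
    · simp [ballInd, hx]
  refine (ENNReal.tsum_le_tsum h1).trans ?_
  rw [ENNReal.tsum_mul_left, tsum_ballInd, mul_assoc,
    ENNReal.inv_mul_cancel (vol_ne_zero _ _) (vol_ne_top _ _), mul_one]

/-- For x in B_R(y), B_R(x) ⊆ B_{2R}(y), so one doubling gives |B_R(x)| ≤ D |B_R(y)|. -/
theorem one_le_tsum_weight {D : ℕ} (hG : IsDoubling G D) {R : ℕ} (hR : 1 ≤ R) (y : V) :
    1 ≤ (D : ℝ≥0∞) * ∑' x, (vol G R x)⁻¹ * ballInd G R x y := by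
  have h1 : ∀ x, (vol G R y)⁻¹ * ballInd G R y x ≤
      (D : ℝ≥0∞) * ((vol G R x)⁻¹ * ballInd G R x y) := by
    intro x
    rw [ballInd_comm R x y, ← mul_assoc]
    by_cases hx : x ∈ closedBall G y R
    · gcongr
      refine inv_le_mul_inv_of_le_mul (vol_ne_zero _ _) (vol_ne_top _ _) (vol_ne_zero _ _)
        (vol_ne_top _ _) ?_
      exact (vol_mono fun z hz => closedBall_trans hx hz (by omega)).trans (hG.vol_le hR y)
    · simp [ballInd, hx]
  rw [← ENNReal.tsum_mul_left]
  refine le_trans (le_of_eq ?_) (ENNReal.tsum_le_tsum h1)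
  rw [ENNReal.tsum_mul_left, tsum_ballInd,
    ENNReal.inv_mul_cancel (vol_ne_zero _ _) (vol_ne_top _ _)]

/-- The commutator of Δ with multiplication by φ sees φ only through its differences along edges,
which are small for cutoffs. -/
theorem lapShift_mul (z : ℂ) (φ : V → ℝ) (f : V → ℂ) (y : V) :
    lapShift G z (fun v => φ v * f v) y = φ y * lapShift G z f y +
      ∑ v ∈ G.neighborFinset y, ((φ y - φ v : ℝ) : ℂ) * f v := by
  simp only [lapShift, lapFun, Complex.ofReal_sub, sub_mul, Finset.sum_sub_distrib,
    ← Finset.mul_sum]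
  ring

/-- The factor 2 comes from ‖a + b‖² ≤ 2‖a‖² + 2‖b‖², and d from Cauchy–Schwarz over the neighbours.
-/
theorem norm_lapShift_cutoff_sq_le {d : ℕ} (hd : ∀ x, G.degree x ≤ d) {R : ℕ} (hR : 1 ≤ R)
    (z : ℂ) (f : V → ℂ) (x y : V) :
    ‖lapShift G z (fun v => cutoff G R x v * f v) y‖ ^ 2 ≤
      2 * ((closedBall G x (4 * R)).indicator 1 y * ‖lapShift G z f y‖ ^ 2) +
      2 * d / R ^ 2 *
        ∑ v ∈ G.neighborFinset y, (closedBall G x (4 * R)).indicator 1 v * ‖f v‖ ^ 2 := by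
  rw [lapShift_mul]
  have h1 : ‖(cutoff G R x y : ℂ) * lapShift G z f y‖ ^ 2 ≤
      (closedBall G x (4 * R)).indicator 1 y * ‖lapShift G z f y‖ ^ 2 := by
    rw [norm_mul, mul_pow, Complex.norm_real, Real.norm_eq_abs, sq_abs]
    gcongr
    exact cutoff_sq_le x y
  have h2 : ‖∑ v ∈ G.neighborFinset y, ((cutoff G R x y - cutoff G R x v : ℝ) : ℂ) * f v‖ ^ 2 ≤
      d / R ^ 2 *
        ∑ v ∈ G.neighborFinset y, (closedBall G x (4 * R)).indicator 1 v * ‖f v‖ ^ 2 := by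
    calc _ ≤ (∑ v ∈ G.neighborFinset y,
            ‖((cutoff G R x y - cutoff G R x v : ℝ) : ℂ) * f v‖) ^ 2 := by
          gcongr
          exact norm_sum_le _ _
      _ ≤ d * ∑ v ∈ G.neighborFinset y,
            ‖((cutoff G R x y - cutoff G R x v : ℝ) : ℂ) * f v‖ ^ 2 := by
          refine (sq_sum_le_card_mul_sum_sq).trans ?_
          rw [G.card_neighborFinset_eq_degree]
          gcongr
          exact hd y
      _ ≤ d * ∑ v ∈ G.neighborFinset y,
            (closedBall G x (4 * R)).indicator 1 v / (R : ℝ) ^ 2 * ‖f v‖ ^ 2 := by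
          gcongr with v hv
          rw [norm_mul, mul_pow, Complex.norm_real, Real.norm_eq_abs, sq_abs]
          gcongr
          exact cutoff_sub_sq_le hR (by simpa using hv)
      _ = _ := by
          rw [Finset.mul_sum, Finset.mul_sum]
          exact Finset.sum_congr rfl fun v _ => by ring
  have h3 : ∀ a b : ℂ, ‖a + b‖ ^ 2 ≤ 2 * ‖a‖ ^ 2 + 2 * ‖b‖ ^ 2 := fun a b => by
    have : ‖a + b‖ ^ 2 ≤ (‖a‖ + ‖b‖) ^ 2 := by
      gcongr
      exact norm_add_le a b
    nlinarith [sq_nonneg (‖a‖ - ‖b‖)]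
  refine (h3 _ _).trans ?_
  rw [mul_div_assoc, mul_assoc (2 : ℝ)]
  gcongr

theorem enorm_lapShift_cutoff_sq_le {d : ℕ} (hd : ∀ x, G.degree x ≤ d) {R : ℕ} (hR : 1 ≤ R)
    (z : ℂ) (f : V → ℂ) (x y : V) :
    ‖lapShift G z (fun v => cutoff G R x v * f v) y‖ₑ ^ 2 ≤
      2 * (ballInd G (4 * R) x y * ‖lapShift G z f y‖ₑ ^ 2) +
      ENNReal.ofReal (2 * d / R ^ 2) *
        ∑ v ∈ G.neighborFinset y, ballInd G (4 * R) x v * ‖f v‖ₑ ^ 2 := by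
  have h0 : ∀ v, 0 ≤ (closedBall G x (4 * R)).indicator (1 : V → ℝ) v := fun v =>
    Set.indicator_nonneg (fun _ _ => zero_le_one) _
  have h := ENNReal.ofReal_le_ofReal (norm_lapShift_cutoff_sq_le hd hR z f x y)
  have h1 : 0 ≤ ∑ v ∈ G.neighborFinset y,
      (closedBall G x (4 * R)).indicator (1 : V → ℝ) v * ‖f v‖ ^ 2 :=
    Finset.sum_nonneg fun v _ => mul_nonneg (h0 v) (by positivity)
  rw [ENNReal.ofReal_add (mul_nonneg zero_le_two (mul_nonneg (h0 y) (by positivity)))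
    (mul_nonneg (by positivity) h1), ENNReal.ofReal_mul zero_le_two,
    ENNReal.ofReal_mul (by positivity : (0 : ℝ) ≤ 2 * d / R ^ 2), ENNReal.ofReal_sum_of_nonneg
      (fun v _ => mul_nonneg (h0 v) (by positivity)), ENNReal.ofReal_pow (norm_nonneg _),
    ofReal_norm] at h
  simpa only [ofReal_indicator_mul, ENNReal.ofReal_ofNat] using h

theorem tsum_sum_neighborFinset_le {d : ℕ} (hd : ∀ x, G.degree x ≤ d) (h : V → ℝ≥0∞) :
    ∑' y, ∑ v ∈ G.neighborFinset y, h v ≤ d * ∑' v, h v := by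
  classical
  have h1 : ∀ y, ∑ v ∈ G.neighborFinset y, h v = ∑' v, if G.Adj y v then h v else 0 := by
    intro y
    rw [tsum_eq_sum (s := G.neighborFinset y) fun v hv => if_neg (by simpa using hv)]
    exact Finset.sum_congr rfl fun v hv => (if_pos (by simpa using hv)).symm
  have h2 : ∀ v, ∑' y, (if G.Adj y v then h v else 0) ≤ d * h v := by
    intro v
    rw [tsum_eq_sum (s := G.neighborFinset v) fun y hy =>
      if_neg (by simpa [G.adj_comm] using hy)]
    refine (Finset.sum_le_sum (g := fun _ => h v) fun y _ => ?_).trans ?_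
    · split_ifs <;> simp
    · rw [Finset.sum_const, nsmul_eq_mul, G.card_neighborFinset_eq_degree]
      gcongr
      exact hd v
  simp only [h1]
  rw [ENNReal.tsum_comm, ← ENNReal.tsum_mul_left]
  exact ENNReal.tsum_le_tsum h2

theorem sqNorm_lapShift_cutoff_le {d : ℕ} (hd : ∀ x, G.degree x ≤ d) {R : ℕ} (hR : 1 ≤ R)
    (z : ℂ) (f : V → ℂ) (x : V) :
    sqNorm (lapShift G z fun v => cutoff G R x v * f v) ≤
      ∑' y, ballInd G (4 * R) x y *
        (2 * ‖lapShift G z f y‖ₑ ^ 2 + ENNReal.ofReal (2 * d / R ^ 2) * d * ‖f y‖ₑ ^ 2) := by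
  refine (ENNReal.tsum_le_tsum fun y => enorm_lapShift_cutoff_sq_le hd hR z f x y).trans ?_
  rw [ENNReal.tsum_add, ENNReal.tsum_mul_left, ENNReal.tsum_mul_left]
  refine (add_le_add_right (mul_le_mul_right (tsum_sum_neighborFinset_le hd _) _) _).trans ?_
  rw [← ENNReal.tsum_mul_left, ← ENNReal.tsum_mul_left, ← ENNReal.tsum_mul_left,
    ← ENNReal.tsum_add]
  refine ENNReal.tsum_le_tsum fun y => le_of_eq ?_
  ring

theorem tsum_weight_mul_le {D : ℕ} (hG : IsDoubling G D) {R : ℕ} (hR : 1 ≤ R) (h : V → ℝ≥0∞) :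
    ∑' x, (vol G R x)⁻¹ * ∑' y, ballInd G (4 * R) x y * h y ≤ (D : ℝ≥0∞) ^ 3 * ∑' y, h y := by
  simp only [← ENNReal.tsum_mul_left, ← mul_assoc]
  rw [ENNReal.tsum_comm]
  refine ENNReal.tsum_le_tsum fun y => ?_
  rw [ENNReal.tsum_mul_right]
  gcongr
  exact tsum_weight_le hG hR y

theorem sqNorm_le_tsum_weight {D : ℕ} (hG : IsDoubling G D) {R : ℕ} (hR : 1 ≤ R) (f : V → ℂ) :
    sqNorm f ≤ D * ∑' x, (vol G R x)⁻¹ * sqNorm (fun v => cutoff G R x v * f v) := by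
  have h1 : ∀ x y, ballInd G R x y * ‖f y‖ₑ ^ 2 ≤ ‖(cutoff G R x y : ℂ) * f y‖ₑ ^ 2 := by
    intro x y
    by_cases hy : y ∈ closedBall G x R
    · simp [ballInd, hy, cutoff_eq_one hR hy]
    · simp [ballInd, hy]
  calc sqNorm f ≤ ∑' y, (D * ∑' x, (vol G R x)⁻¹ * ballInd G R x y) * ‖f y‖ₑ ^ 2 := by
        refine ENNReal.tsum_le_tsum fun y => ?_
        exact le_mul_of_one_le_left zero_le (one_le_tsum_weight hG hR y)
    _ = D * ∑' x, (vol G R x)⁻¹ * ∑' y, ballInd G R x y * ‖f y‖ₑ ^ 2 := by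
        simp only [← ENNReal.tsum_mul_left, ← ENNReal.tsum_mul_right]
        rw [ENNReal.tsum_comm]
        simp only [mul_assoc]
    _ ≤ _ := by
        gcongr with x
        exact ENNReal.tsum_le_tsum (h1 x)

/-- An approximate eigenfunction of the Laplacian of a doubling graph can be localized to a ball,
with a loss that depends only on the radius and on the degree and doubling bounds. -/
theorem IsDoubling.exists_localized {d D : ℕ} (hd : ∀ x, G.degree x ≤ d) (hG : IsDoubling G D)
    {R : ℕ} (hR : 1 ≤ R) (z : ℂ) (f : V → ℂ) (C : ℝ≥0∞)
    (h : (D : ℝ≥0∞) ^ 4 * (2 * sqNorm (lapShift G z f) +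
      ENNReal.ofReal (2 * d / R ^ 2) * d * sqNorm f) < C * sqNorm f) :
    ∃ (x : V) (g : V → ℂ), (∀ v ∉ closedBall G x (2 * R), g v = 0) ∧
      sqNorm (lapShift G z g) < C * sqNorm g := by
  -- If every cutoff of f failed, the weighted sum of the failures over all centres would contradict
  -- `h`.
  by_contra! hcon
  refine absurd h (not_lt.2 ?_)
  calc C * sqNorm f
      ≤ C * (D * ∑' x, (vol G R x)⁻¹ * sqNorm (fun v => cutoff G R x v * f v)) := by
        gcongr
        exact sqNorm_le_tsum_weight hG hR f
    _ = D * ∑' x, (vol G R x)⁻¹ * (C * sqNorm (fun v => cutoff G R x v * f v)) := by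
        simp only [← ENNReal.tsum_mul_left]
        exact tsum_congr fun x => by ring
    _ ≤ D * ∑' x, (vol G R x)⁻¹ * ∑' y, ballInd G (4 * R) x y *
        (2 * ‖lapShift G z f y‖ₑ ^ 2 + ENNReal.ofReal (2 * d / R ^ 2) * d * ‖f y‖ₑ ^ 2) := by
        gcongr with x
        refine (hcon x _ fun v hv => ?_).trans (sqNorm_lapShift_cutoff_le hd hR z f x)
        simp [cutoff_eq_zero hv]
    _ ≤ D * (D ^ 3 * ∑' y,
        (2 * ‖lapShift G z f y‖ₑ ^ 2 + ENNReal.ofReal (2 * d / R ^ 2) * d * ‖f y‖ₑ ^ 2)) := by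
        gcongr
        exact tsum_weight_mul_le hG hR _
    _ = _ := by
        rw [ENNReal.tsum_add, ENNReal.tsum_mul_left, ENNReal.tsum_mul_left, ← mul_assoc,
          ← pow_succ']
        rfl

end Localization

/-! ### Comparison of the two spectra -/

theorem exists_mem_spec_near {V W : Type*} {G : SimpleGraph V} {H : SimpleGraph W}
    [G.LocallyFinite] [H.LocallyFinite] {d D : ℕ} (hD : 0 < D) (hGd : ∀ x, G.degree x ≤ d)
    (hHd : ∀ x, H.degree x ≤ d) (hG : IsDoubling G D) {ε : ℝ} (hε : 0 < ε) {R : ℕ} (hR : 1 ≤ R)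
    (hRε : (D : ℝ) ^ 4 * (2 * d / R ^ 2 * d) < ε ^ 2 / 2)
    (hGH : ∀ x, ∃ y, BallIso G H (2 * R + 2) x y) {z : ℂ} (hz : z ∈ spec G hGd) :
    ∃ w ∈ spec H hHd, ‖z - w‖ ≤ ε := by
  have hD' : (0 : ℝ) < D := by exact_mod_cast hD
  -- After squaring and multiplying by 2D⁴, this tolerance contributes ε²/2; the cutoff error `hRε`
  -- takes the other half.
  obtain ⟨f, hf⟩ := exists_approx_eigenvector (laplacian_isSelfAdjoint hGd) hz
    (by positivity : 0 < ε / (2 * (D : ℝ) ^ 2))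
  have hf0 : 0 < ‖f‖ := by
    refine pos_of_mul_pos_right ((norm_nonneg _).trans_lt hf) (by positivity)
  have hreal : (D : ℝ) ^ 4 * (2 * ‖laplacian G hGd f - z • f‖ ^ 2 +
      2 * d / R ^ 2 * d * ‖f‖ ^ 2) < ε ^ 2 * ‖f‖ ^ 2 := by
    have h1 : ‖laplacian G hGd f - z • f‖ ^ 2 ≤ (ε / (2 * (D : ℝ) ^ 2) * ‖f‖) ^ 2 := by
      gcongr
    have h2 : (D : ℝ) ^ 4 * (2 * (ε / (2 * (D : ℝ) ^ 2) * ‖f‖) ^ 2) = ε ^ 2 / 2 * ‖f‖ ^ 2 := by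
      field_simp
    have h3 := mul_lt_mul_of_pos_right hRε (by positivity : 0 < ‖f‖ ^ 2)
    have h4 := mul_le_mul_of_nonneg_left h1 (by positivity : 0 ≤ (D : ℝ) ^ 4 * 2)
    linarith
  obtain ⟨x, g, hg, hlt⟩ := hG.exists_localized hGd hR z f (ENNReal.ofReal (ε ^ 2)) (by
    have h := (ENNReal.ofReal_lt_ofReal_iff (by positivity)).2 hreal
    rw [ENNReal.ofReal_mul (by positivity), ENNReal.ofReal_add (by positivity) (by positivity),
      ENNReal.ofReal_mul zero_le_two, ENNReal.ofReal_mul (by positivity),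
      ENNReal.ofReal_mul (by positivity), ENNReal.ofReal_mul (by positivity),
      ENNReal.ofReal_pow (by positivity)] at h
    rw [← coe_laplacian_sub hGd, sqNorm_coe, sqNorm_coe]
    simpa only [ENNReal.ofReal_natCast, ENNReal.ofReal_ofNat] using h)
  obtain ⟨y, hxy⟩ := hGH x
  obtain ⟨g', hg', h1, h2⟩ := hxy.exists_transfer z hg
  rw [← h1, ← h2] at hlt
  -- `g'` has finite support, since balls are finite.
  have hmem : Memℓp g' 2 := by
    refine (memℓp_zero ((closedBall_finite (G := H) y (2 * R)).subset fun v hv => ?_)).of_exponent_ge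
      (by simp)
    by_contra hcon
    exact hv (hg' v hcon)
  set F : lp (fun _ : W => ℂ) 2 := ⟨g', hmem⟩ with hF
  have hFg : (F : W → ℂ) = g' := rfl
  rw [← hFg, ← coe_laplacian_sub hHd, sqNorm_coe, sqNorm_coe, ← ENNReal.ofReal_mul (by positivity)]
    at hlt
  have hlt' := (ENNReal.ofReal_lt_ofReal_iff_of_nonneg (by positivity)).1 hlt
  rw [← mul_pow] at hlt'
  have hlt2 := lt_of_pow_lt_pow_left₀ 2 (by positivity) hlt'
  have hF0 : F ≠ 0 := by
    intro h
    simp [h] at hlt2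
  exact exists_mem_spectrum_near (laplacian_isSelfAdjoint hHd) hε hF0 hlt2

end GraphSpec

theorem mainTheorem3 (d D : ℕ) (hD : 0 < D)
    {V : ℕ → Type*} [∀ n, Countable (V n)] (G : ∀ n, SimpleGraph (V n))
    [∀ n, (G n).LocallyFinite] (hG : ∀ n x, (G n).degree x ≤ d)
    {W : Type*} (H : SimpleGraph W) [H.LocallyFinite] (hH : ∀ x, H.degree x ≤ d)
    (hdoubling : ∀ n, GraphSpec.IsDoubling (G n) D)
    (hconv : GraphSpec.ConvergesTopologically G H) :
    Tendsto (fun n => Metric.hausdorffEDist (GraphSpec.spec (G n) (hG n)) (GraphSpec.spec H hH))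
      atTop (𝓝 0) := by
  rw [ENNReal.tendsto_nhds_zero]
  intro η hη
  obtain ⟨ε, hε, hεη⟩ : ∃ ε : ℝ, 0 < ε ∧ ENNReal.ofReal ε ≤ η := by
    obtain ⟨q, hq, hqη⟩ := ENNReal.lt_iff_exists_nnreal_btwn.1 hη
    exact ⟨q, by exact_mod_cast hq, by simpa using hqη.le⟩
  have hlim : Tendsto (fun R : ℕ => (D : ℝ) ^ 4 * (2 * d / (R : ℝ) ^ 2 * d)) atTop (𝓝 0) := by
    have h1 : Tendsto (fun R : ℕ => 2 * (d : ℝ) / (R : ℝ) ^ 2) atTop (𝓝 0) :=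
      tendsto_const_nhds.div_atTop
        ((tendsto_pow_atTop two_ne_zero).comp tendsto_natCast_atTop_atTop)
    simpa using (h1.mul_const (d : ℝ)).const_mul ((D : ℝ) ^ 4)
  -- R is fixed before n: it depends only on ε, d and D, so agreement of balls of this one radius
  -- suffices.
  obtain ⟨R, hRε, hR⟩ := ((hlim.eventually_lt_const (by positivity : 0 < ε ^ 2 / 2)).and
    (eventually_ge_atTop 1)).exists
  filter_upwards [hconv.eventually_sameBalls (r := 2 * R + 2) (by omega)] with n hn
  refine (Metric.hausdorffEDist_le_of_mem_edist (r := ENNReal.ofReal ε) ?_ ?_).trans hεη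
  · intro z hz
    obtain ⟨w, hw, h⟩ :=
      GraphSpec.exists_mem_spec_near hD (hG n) hH (hdoubling n) hε hR hRε hn.1 hz
    exact ⟨w, hw, by rw [edist_dist, dist_eq_norm]; exact ENNReal.ofReal_le_ofReal h⟩
  · intro z hz
    obtain ⟨w, hw, h⟩ := GraphSpec.exists_mem_spec_near hD hH (hG n)
      (hconv.isDoubling hdoubling) hε hR hRε hn.symm.1 hz
    exact ⟨w, hw, by rw [edist_dist, dist_eq_norm]; exact ENNReal.ofReal_le_ofReal h⟩
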